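/- **Conventions.** For coprime non-negative integers $p,q$ and an ordered alphabet $\{s<t\}$, the Christoffel word of slope $q/p$ over $\{s<t\}$ is the word $c[0]c[1]\cdots c[N-1]$ of length $N=p+q$ with $c[i]=s$ if $(i+1)q \bmod N > iq \bmod N$ and $c[i]=t$ otherwise (for $p=1$, $q=0$ it is the one-letter word $s$). It has $p$ letters $s$ and $q$ letters $t$. If $p\le n$ and $\gcd(n,p)=1$, then $C(n,p)$ denotes the Christoffel word of length $n$ and slope $(n-p)/p$. The reversal of a word $c$ is denoted by $\widetilde c$. Let $u$ be a word of length $n$ over $\{a,z\}$ and $v$ a word of length $m$ over $\{b,z\}$, let $A$ be the set of positions of the letter $a$ in $u$ and $B$ the set of positions of the letter $b$ in $v$. The words $u$ and $v$ are superimposable if $(A+n\mathbb Z)\cap(B-k+m\mathbb Z)=\emptyset$ for some $k\in\mathbb Z$, and perfectly superimposable if this holds with $k=0$. **Theorem.** Let $n,\alpha,\beta$ be non-negative integers with $\alpha,\beta\le n$ and $\gcd(n,\alpha)=\gcd(n,\beta)=\gcd(\alpha,\beta)=1$, and suppose that the Christoffel words $u=C(n,\alpha)$ over $\{a<z\}$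 and $C(n,\beta)$ over $\{b<z\}$ are superimposable. Then the reversal $v=\widetilde C(n,\beta)$ is a conjugate (cyclic rotation) of $C(n,\beta)$, and $u$ and $v$ are perfectly superimposable. Let $w$ be the word of length $n$ with $w[i]=a$ if $u[i]=a$, $w[i]=b$ if $v[i]=b$, and $w[i]=z$ otherwise, and let $w'$ be the word obtained from $w$ by removing all letters $z$. Then $w'$ is the Christoffel word of slope $\beta/\alpha$ over $\{a<b\}$. -/

import Mathlib

namespace ChristoffelSuperposition

/-- The three letters `a`, `b`, `z`. -/
inductive Letter where
  | a : Letter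
  | b : Letter
  | z : Letter
  deriving DecidableEq

/-- The Christoffel word over the ordered alphabet `{s < t}` with `p` occurrences of `s` and
`q` occurrences of `t` (for coprime `p`, `q`); it is the Christoffel word of slope `q / p`.
With `N = p + q`, its `i`-th letter (`0 ≤ i < N`) is `s` if `i q mod N < (i + 1) q mod N`, and `t`
otherwise. The disjunct `q = 0` concerns only the one-letter word `s` (`p = 1`, `q = 0`). -/
def christoffel {A : Type*} (s t : A) (p q : ℕ) : List A :=
  (List.range (p + q)).map fun i =>
    if q = 0 ∨ (i * q) % (p + q) < ((i + 1) * q) % (p + q) then s else t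

/-- `C(n, p)` over `{s < t}`, for `p ≤ n` coprime to `n`: the Christoffel word of length `n` with
`p` occurrences of `s`, that is, the one of slope `(n - p) / p`. -/
def christoffelC {A : Type*} (s t : A) (n p : ℕ) : List A :=
  christoffel s t p (n - p)

/-- The set of positions of the letter `s` in the bi-infinite periodic word with period `u`:
the set `P + |u| ℤ`, where `P` is the set of positions of `s` in `u`. -/
def periodicPositions {A : Type*} (s : A) (u : List A) : Set ℤ :=
  {i | ∃ j : ℕ, u[j]? = some s ∧ ∃ m : ℤ, i = (j : ℤ) + m * (u.length : ℤ)}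

/-- `(P + |u| ℤ) ∩ (Q - k + |v| ℤ) = ∅`, where `P` is the set of positions of `s` in `u` and `Q` is
the set of positions of `t` in `v`. -/
def SuperimposableAt {A : Type*} (s t : A) (u v : List A) (k : ℤ) : Prop :=
  periodicPositions s u ∩ {i | i + k ∈ periodicPositions t v} = ∅

/-- `u` and `v` are superimposable (with respect to the letter `s` of `u` and the letter `t`
of `v`). -/
def Superimposable {A : Type*} (s t : A) (u v : List A) : Prop :=
  ∃ k : ℤ, SuperimposableAt s t u v k

/-- `u` and `v` are perfectly superimposable: superimposable with shift `0`. -/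
def PerfectlySuperimposable {A : Type*} (s t : A) (u v : List A) : Prop :=
  SuperimposableAt s t u v 0

/-- The word `w` with `w[i] = a` if `u[i] = a`, `w[i] = b` if `v[i] = b`, `w[i] = z` otherwise. -/
def overlay (u v : List Letter) : List Letter :=
  List.zipWith (fun x y =>
    if x = Letter.a then Letter.a else if y = Letter.b then Letter.b else Letter.z) u v

/-- The word obtained from `w` by removing every letter `z`. -/
def removeZ (w : List Letter) : List Letter :=
  w.filter fun x => x ≠ Letter.z

end ChristoffelSuperposition

namespace ChristoffelSuperposition

/-- Modulo `p + q` one has `q ≡ -p`, and adding `q` raises a residue without wrapping exactly when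
it is below `p`. This form also absorbs the exceptional case `q = 0`. -/
theorem christoffel_eq_map {A : Type*} (s t : A) (p q : ℕ) :
    christoffel s t p q = (List.range (p + q)).map fun i : ℕ =>
      if (-((i : ℤ) * p)) % ((p + q : ℕ) : ℤ) < p then s else t := by
  unfold christoffel
  refine List.map_congr_left fun i hi => ?_
  have hN : 0 < p + q := by have := List.mem_range.1 hi; omega
  have h1 : (-((i : ℤ) * p)) % ((p + q : ℕ) : ℤ) = ((i * q % (p + q) : ℕ) : ℤ) := by
    rw [Int.natCast_mod]
    refine Int.ModEq.eq (Int.modEq_iff_dvd.2 ⟨i, ?_⟩)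
    push_cast
    ring
  have h2 : (i + 1) * q % (p + q) = (i * q % (p + q) + q) % (p + q) := by
    rw [Nat.mod_add_mod, add_mul, one_mul]
  rw [h1, h2]
  have hr := Nat.mod_lt (i * q) hN
  have hz : q = 0 → i * q % (p + q) = 0 := by rintro rfl; simp
  generalize i * q % (p + q) = r at *
  refine if_congr ?_ rfl rfl
  rw [Nat.cast_lt]
  rcases lt_or_ge r p with h | h
  · rw [Nat.mod_eq_of_lt (by omega)]
    omega
  · rw [Nat.mod_eq_sub_mod (by omega), Nat.mod_eq_of_lt (by omega)]
    omega

theorem christoffelC_eq_map {A : Type*} (s t : A) {n p : ℕ} (h : p ≤ n) :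
    christoffelC s t n p = (List.range n).map fun i : ℕ =>
      if (-((i : ℤ) * p)) % (n : ℤ) < p then s else t := by
  rw [christoffelC, christoffel_eq_map, Nat.add_sub_cancel' h]

theorem reverse_christoffelC_eq_map {A : Type*} (s t : A) {n p : ℕ} (h : p ≤ n) :
    (christoffelC s t n p).reverse = (List.range n).map fun i : ℕ =>
      if (((i : ℤ) + 1) * p) % (n : ℤ) < p then s else t := by
  rw [christoffelC_eq_map s t h]
  refine List.ext_getElem (by simp) fun i h1 h2 => ?_
  simp only [List.length_map, List.length_range] at h2
  simp only [List.getElem_reverse, List.getElem_map, List.getElem_range, List.length_map,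
    List.length_range]
  have : (-(((n - 1 - i : ℕ) : ℤ) * p)) % (n : ℤ) = (((i : ℤ) + 1) * p) % (n : ℤ) := by
    refine Int.ModEq.eq (Int.modEq_iff_dvd.2 ⟨p, ?_⟩)
    rw [show ((n - 1 - i : ℕ) : ℤ) = n - 1 - i by omega]
    ring
  rw [this]

/-- Membership in the periodic extension of a word given by an `n`-periodic predicate. -/
theorem mem_periodicPositions_map {A : Type*} {s t : A} (hst : t ≠ s) {n : ℕ} (hn : 0 < n)
    (f : ℤ → Prop) [DecidablePred f] (hf : ∀ i m : ℤ, f (i + m * n) ↔ f i) (i : ℤ) :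
    i ∈ periodicPositions s ((List.range n).map fun j : ℕ => if f j then s else t) ↔ f i := by
  simp only [periodicPositions, Set.mem_ofPred_eq, List.length_map, List.length_range]
  constructor
  · rintro ⟨j, hj, m, rfl⟩
    rw [hf]
    rw [List.getElem?_map, Option.map_eq_some_iff] at hj
    obtain ⟨k, hk, hk'⟩ := hj
    obtain ⟨_, rfl⟩ := List.getElem?_eq_some_iff.1 hk
    rw [List.getElem_range] at hk'
    by_contra hc
    rw [if_neg hc] at hk'
    exact hst hk'
  · intro h
    have h0 : 0 ≤ i % n := Int.emod_nonneg _ (by omega)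
    have h1 : i % n < n := Int.emod_lt_of_pos _ (by omega)
    have h2 := Int.emod_add_mul_ediv i n
    refine ⟨(i % n).toNat, ?_, i / n, by rw [Int.toNat_of_nonneg h0]; linarith⟩
    have h3 : f (((i % n).toNat : ℕ) : ℤ) := by
      rw [Int.toNat_of_nonneg h0, ← hf _ (i / n)]
      rwa [show i % n + i / n * n = i by linarith]
    rw [List.getElem?_map, List.getElem?_range (by omega)]
    rw [Option.map_some, if_pos h3]

theorem mem_periodicPositions_christoffelC {A : Type*} {s t : A} (hst : t ≠ s) {n p : ℕ}
    (hn : 0 < n) (h : p ≤ n) (i : ℤ) :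
    i ∈ periodicPositions s (christoffelC s t n p) ↔ (-(i * p)) % (n : ℤ) < p := by
  rw [christoffelC_eq_map s t h]
  refine mem_periodicPositions_map hst hn (fun i : ℤ => (-(i * p)) % (n : ℤ) < p) ?_ i
  intro i m
  rw [show -((i + m * n) * p) = -(i * p) + n * (-(m * p)) by ring, Int.add_mul_emod_self_left]

theorem mem_periodicPositions_reverse_christoffelC {A : Type*} {s t : A} (hst : t ≠ s) {n p : ℕ}
    (hn : 0 < n) (h : p ≤ n) (i : ℤ) :
    i ∈ periodicPositions s (christoffelC s t n p).reverse ↔ ((i + 1) * p) % (n : ℤ) < p := by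
  rw [reverse_christoffelC_eq_map s t h]
  refine mem_periodicPositions_map hst hn (fun i : ℤ => ((i + 1) * p) % (n : ℤ) < p) ?_ i
  intro i m
  rw [show (i + m * n + 1) * p = (i + 1) * p + n * (m * p) by ring, Int.add_mul_emod_self_left]

theorem exists_nat_mul_modEq_one {n p : ℕ} (hn : 0 < n) (h : Nat.Coprime n p) :
    ∃ r : ℕ, (n : ℤ) ∣ r * p - 1 := by
  obtain ⟨x, y, hxy⟩ := (Nat.isCoprime_iff_coprime.2 h)
  refine ⟨(y % n).toNat, ?_⟩
  rw [Int.toNat_of_nonneg (Int.emod_nonneg _ (by omega))]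
  refine ⟨-(x + y / n * p), ?_⟩
  have := Int.emod_add_mul_ediv y n
  linear_combination hxy + (p : ℤ) * this

/-- Rotating by the inverse `r` of `p` mod `n` changes the residue `-ip` to `-ip - 1`, which sums
with `(i+1)p` to `p - 1`; the reflection `x ↦ p - 1 - x` preserves `[0, p)`. -/
theorem isRotated_reverse_christoffelC {A : Type*} (s t : A) {n p : ℕ} (hn : 0 < n) (h : p ≤ n)
    (hc : Nat.Coprime n p) :
    (christoffelC s t n p).reverse ~r christoffelC s t n p := by
  obtain ⟨r, k, hk⟩ := exists_nat_mul_modEq_one hn hc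
  refine List.IsRotated.symm ⟨r, ?_⟩
  rw [reverse_christoffelC_eq_map s t h, christoffelC_eq_map s t h]
  refine List.ext_getElem (by simp) fun i h1 h2 => ?_
  simp only [List.getElem_rotate, List.getElem_map, List.getElem_range, List.length_map,
    List.length_range]
  refine if_congr ?_ rfl rfl
  have hn' : (0 : ℤ) < n := by exact_mod_cast hn
  have hp : (p : ℤ) ≤ n := by exact_mod_cast h
  have key : ∀ a b : ℤ, (n : ℤ) ∣ a + b - (p - 1) → a % n < p → b % n < p := by
    rintro a b ⟨c, hc⟩ ha
    have ha0 := Int.emod_nonneg a hn'.ne'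
    have : b % n = p - 1 - a % n := by
      have hb : b = p - 1 - a % n + n * (c - a / n) := by
        have := Int.emod_add_mul_ediv a n
        linear_combination hc + this
      conv_lhs => rw [hb]
      rw [Int.add_mul_emod_self_left, Int.emod_eq_of_lt (by omega) (by omega)]
    omega
  have hd : (n : ℤ) ∣ -((((i + r) % n : ℕ) : ℤ) * p) + ((i : ℤ) + 1) * p - (p - 1) := by
    refine ⟨-k + ((i + r : ℤ) / n) * p, ?_⟩
    have := Int.emod_add_mul_ediv (i + r : ℤ) n
    push_cast
    linear_combination (-1 : ℤ) * hk - (p : ℤ) * this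
  exact ⟨key _ _ hd, key _ _ (by rwa [add_comm (((i : ℤ) + 1) * p)])⟩

/-! ### Superimposability and positive combinations -/

/-- Every integer is `s b + y a` with `0 ≤ s < a`, for coprime `a > 0` and `b`. -/
theorem exists_bounded_combination {a b : ℤ} (ha : 0 < a) (hab : IsCoprime a b) (e : ℤ) :
    ∃ s y : ℤ, 0 ≤ s ∧ s < a ∧ e = s * b + y * a := by
  obtain ⟨x, y, hxy⟩ := hab
  refine ⟨(e * y) % a, e * x + (e * y) / a * b, Int.emod_nonneg _ ha.ne', Int.emod_lt_of_pos _ ha,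
    ?_⟩
  have := Int.emod_add_mul_ediv (e * y) a
  linear_combination (-e) * hxy - b * this

/-- If `n` is not a positive combination of the coprime `a, b > 0`, then the box
`{s b + y a : 0 ≤ s < a, 0 ≤ y < b}` covers all residues modulo `n`. -/
theorem exists_box_modEq {a b n : ℤ} (ha : 0 < a) (hb : 0 < b) (hn : 0 < n) (hab : IsCoprime a b)
    (hrep : ¬ ∃ x y : ℤ, 0 < x ∧ 0 < y ∧ n = x * a + y * b) (c : ℤ) :
    ∃ s y : ℤ, 0 ≤ s ∧ s < a ∧ 0 ≤ y ∧ y < b ∧ n ∣ s * b + y * a - c := by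
  -- The representative of `c` in `[ab - n, ab)`: `e < ab` forces `y < b`, and `e + n ≥ ab` makes `e
  -- + n` available when `y < 0`.
  set e : ℤ := a * b - n + (c - (a * b - n)) % n with he
  have h0 := Int.emod_nonneg (c - (a * b - n)) hn.ne'
  have h1 := Int.emod_lt_of_pos (c - (a * b - n)) hn
  have hec : n ∣ e - c := by
    refine ⟨-((c - (a * b - n)) / n), ?_⟩
    have := Int.emod_add_mul_ediv (c - (a * b - n)) n
    linear_combination he + this
  have he1 : e < a * b := by linarith
  obtain ⟨s, y, hs0, hsa, hsy⟩ := exists_bounded_combination ha hab e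
  rcases le_or_gt 0 y with hy | hy
  · refine ⟨s, y, hs0, hsa, hy, ?_, hsy ▸ hec⟩
    nlinarith [mul_nonneg hs0 hb.le]
  · obtain ⟨s', y', hs0', hsa', hsy'⟩ := exists_bounded_combination ha hab (e + n - a * b)
    have hy' : y' < 0 := by
      by_contra! hc
      -- Subtracting the two representations would make `n` a positive combination.
      exact hrep ⟨-y + y', s' + (a - s), by omega, by omega, by linear_combination hsy' - hsy⟩
    refine ⟨s', y' + b, hs0', hsa', ?_, by omega, ?_⟩
    · by_contra! hc
      nlinarith [mul_pos ha (show 0 < -(y' + b) by omega), mul_le_mul_of_nonneg_right hsa'.le hb.le]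
    · rw [show s' * b + (y' + b) * a - c = (e - c) + n by linear_combination -hsy']
      exact dvd_add hec (dvd_refl n)

/-- Otherwise the box covers every residue, in particular the one encoding a collision at shift `k`.
With `s ≡ -ia` and `b - 1 - y ≡ -(i+k)b`, multiplying the latter by `a` gives `sb + ya ≡ kab +
a(b-1)`. -/
theorem exists_positive_combination {a b n k : ℤ} (ha : 0 < a) (hb : 0 < b) (hn : 0 < n)
    (han : a ≤ n) (hbn : b ≤ n) (hab : IsCoprime a b) (hna : IsCoprime n a)
    (hsup : ∀ i : ℤ, ¬ ((-(i * a)) % n < a ∧ (-((i + k) * b)) % n < b)) :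
    ∃ x y : ℤ, 0 < x ∧ 0 < y ∧ n = x * a + y * b := by
  by_contra hrep
  obtain ⟨s, y, hs0, hsa, hy0, hyb, d, hd⟩ :=
    exists_box_modEq ha hb hn hab hrep (k * a * b + a * (b - 1))
  obtain ⟨g, h, hgh⟩ := id hna
  -- `h` inverts `a` mod `n`, so this position has residue `s`.
  refine hsup (-(s * h)) ⟨?_, ?_⟩
  · rw [show -(-(s * h) * a) = s + n * (-(s * g)) by linear_combination s * hgh,
      Int.add_mul_emod_self_left, Int.emod_eq_of_lt hs0 (by omega)]
    exact hsa
  · have hdvd : n ∣ -((-(s * h) + k) * b) - (b - 1 - y) := by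
      refine hna.dvd_of_dvd_mul_right ⟨d - s * b * g, ?_⟩
      linear_combination hd + s * b * hgh
    obtain ⟨m, hm⟩ := hdvd
    rw [show -((-(s * h) + k) * b) = b - 1 - y + n * m by linear_combination hm,
      Int.add_mul_emod_self_left, Int.emod_eq_of_lt (by omega) (by omega)]
    omega

/-- Eliminating `i` and using coprimality gives `a - s - ty = ak` and `r + tx = bk` for the residues
`s`, `r`. If `t > 0`, then `k ≥ 1` contradicts the first equation; if `t ≤ 0`, then `s < a` gives `k
≥ 1` and the second yields `r ≥ b`. -/
theorem not_both_of_positive_combination {a b n x y : ℤ} (ha : 0 < a) (hb : 0 < b) (hn : 0 < n)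
    (hab : IsCoprime a b) (hx : 0 < x) (hy : 0 < y) (hxy : n = x * a + y * b) (i : ℤ) :
    ¬ ((-(i * a)) % n < a ∧ ((i + 1) * b) % n < b) := by
  rintro ⟨h1, h2⟩
  have h10 := Int.emod_nonneg (-(i * a)) hn.ne'
  have h20 := Int.emod_nonneg ((i + 1) * b) hn.ne'
  have e1 := Int.emod_add_mul_ediv (-(i * a)) n
  have e2 := Int.emod_add_mul_ediv ((i + 1) * b) n
  generalize (-(i * a)) % n = s at *
  generalize ((i + 1) * b) % n = r at *
  generalize (-(i * a)) / n = s' at *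
  generalize ((i + 1) * b) / n = r' at *
  obtain ⟨t, ht⟩ : ∃ t, t = s' * b + r' * a := ⟨_, rfl⟩
  have hk : b * (a - s - t * y) = a * (r + t * x) := by
    subst ht
    linear_combination (-b) * e1 - a * e2 + (s' * b + r' * a) * hxy
  obtain ⟨k, hk1⟩ : a ∣ a - s - t * y := hab.dvd_of_dvd_mul_left ⟨_, hk⟩
  have hk2 : r + t * x = b * k := by
    refine mul_left_cancel₀ ha.ne' ?_
    rw [← hk, hk1]
    ring
  rcases lt_or_ge 0 t with htp | htn
  · have hk0 : 0 < k := by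
      have := mul_pos htp hx
      exact pos_of_mul_pos_right (a := b) (by linarith) hb.le
    have := mul_pos htp hy
    nlinarith
  · have hk0 : 0 < k := by
      have := mul_nonneg (neg_nonneg.2 htn) hy.le
      exact pos_of_mul_pos_right (a := a) (by linarith) ha.le
    have := mul_nonneg (neg_nonneg.2 htn) hx.le
    nlinarith

/-! ### Erasing the letters `z` -/

/-- The first `i` letters of an overlay, with the letters `z` removed: `P = ⌈i a / n⌉` and
`Q = ⌊i b / n⌋` count the two remaining letters. -/
theorem exists_filter_prefix_eq {a b n : ℕ} (hn : 0 < n) (hpos : 0 < a + b) (han : a ≤ n)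
    (hbn : b ≤ n)
    (hdisj : ∀ i : ℤ, ¬ ((-(i * a)) % (n : ℤ) < a ∧ ((i + 1) * b) % (n : ℤ) < b)) (i : ℕ) :
    ∃ P Q : ℕ, i * a ≤ P * n ∧ P * n < i * a + n ∧ Q * n ≤ i * b ∧ i * b < Q * n + n ∧
      ((List.range i).map fun j : ℕ =>
        if (-((j : ℤ) * a)) % (n : ℤ) < a then Letter.a
        else if (((j : ℤ) + 1) * b) % (n : ℤ) < b then Letter.b else Letter.z).filter
          (fun x => x ≠ Letter.z) =
      (List.range (P + Q)).map fun j : ℕ =>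
        if (-((j : ℤ) * a)) % ((a + b : ℕ) : ℤ) < a then Letter.a else Letter.b := by
  induction i with
  | zero => exact ⟨0, 0, by simp [hn]⟩
  | succ i ih =>
    obtain ⟨P, Q, hP1, hP2, hQ1, hQ2, ih⟩ := ih
    have hua : (-((i : ℤ) * a)) % (n : ℤ) < a ↔ P * n < (i + 1) * a := by
      have : (-((i : ℤ) * a)) % (n : ℤ) = P * n - i * a := by
        rw [show -((i : ℤ) * a) = P * n - i * a + n * (-P) by ring, Int.add_mul_emod_self_left]
        zify at hP1 hP2
        exact Int.emod_eq_of_lt (by linarith) (by linarith)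
      rw [this]
      zify
      constructor <;> intro h <;> linarith
    have hvb : (((i : ℤ) + 1) * b) % (n : ℤ) < b ↔ Q * n + n ≤ (i + 1) * b := by
      zify at hQ1 hQ2 hbn ⊢
      rcases lt_or_ge (((i : ℤ) + 1) * b) (Q * n + n) with h | h
      · have : (((i : ℤ) + 1) * b) % (n : ℤ) = (i + 1) * b - Q * n := by
          conv_lhs => rw [show ((i : ℤ) + 1) * b = (i + 1) * b - Q * n + n * Q by ring]
          rw [Int.add_mul_emod_self_left]
          exact Int.emod_eq_of_lt (by linarith) (by linarith)
        rw [this]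
        constructor <;> intro h <;> linarith
      · have : (((i : ℤ) + 1) * b) % (n : ℤ) = (i + 1) * b - (Q + 1) * n := by
          conv_lhs => rw [show ((i : ℤ) + 1) * b = (i + 1) * b - (Q + 1) * n + n * (Q + 1) by ring]
          rw [Int.add_mul_emod_self_left]
          exact Int.emod_eq_of_lt (by linarith) (by linarith)
        rw [this]
        constructor <;> intro h <;> linarith
    -- `Pb - Qa` is the residue of `-(P+Q)a` mod `a + b`: the bounds on `P` and `Q` place it in `[0,
    -- a + b)`.
    have hc : (-(((P + Q : ℕ) : ℤ) * a)) % ((a + b : ℕ) : ℤ) < a ↔ P * b < (Q + 1) * a := by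
      have hn' : (0 : ℤ) < n := by exact_mod_cast hn
      have h0 : (0 : ℤ) ≤ P * b - Q * a := by
        zify at hP1 hQ1
        refine nonneg_of_mul_nonneg_right (a := (n : ℤ)) ?_ hn'
        nlinarith [mul_le_mul_of_nonneg_right hP1 (Int.natCast_nonneg b),
          mul_le_mul_of_nonneg_right hQ1 (Int.natCast_nonneg a)]
      have h1 : (P * b - Q * a : ℤ) < a + b := by
        zify at hP2 hQ2 hpos
        refine lt_of_mul_lt_mul_left (a := (n : ℤ)) ?_ hn'.le
        rcases Nat.eq_zero_or_pos a with ha | ha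
        · have hb : (0 : ℤ) < b := by omega
          nlinarith [mul_lt_mul_of_pos_right hP2 hb]
        · nlinarith [mul_le_mul_of_nonneg_right hP2.le (Int.natCast_nonneg b),
            mul_lt_mul_of_pos_right hQ2 (show (0 : ℤ) < a by exact_mod_cast ha)]
      have : (-(((P + Q : ℕ) : ℤ) * a)) % ((a + b : ℕ) : ℤ) = P * b - Q * a := by
        push_cast
        rw [show -(((P : ℤ) + Q) * a) = P * b - Q * a + (a + b) * (-P) by ring,
          Int.add_mul_emod_self_left]
        exact Int.emod_eq_of_lt h0 h1
      rw [this]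
      zify
      constructor <;> intro h <;> linarith
    have hd := hdisj i
    rw [List.range_succ, List.map_append, List.filter_append, ih]
    by_cases h1 : (-((i : ℤ) * a)) % (n : ℤ) < a
    · have h2 : ¬ (((i : ℤ) + 1) * b) % (n : ℤ) < b := fun h => hd ⟨h1, h⟩
      have h1' := hua.1 h1
      have h2' := mt hvb.2 h2
      -- Chain `nPb < (i+1)ab < n(Q+1)a`; for a letter `b` both comparisons reverse, weakly.
      have h3 := hc.2 (by
        refine lt_of_mul_lt_mul_left (a := n) ?_ (Nat.zero_le n)
        have ha : 0 < a := Nat.pos_of_ne_zero (by rintro rfl; simp at h1')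
        nlinarith [Nat.mul_le_mul_right b h1'.le, Nat.mul_lt_mul_of_pos_right (not_le.1 h2') ha])
      refine ⟨P + 1, Q, by nlinarith, by nlinarith, by nlinarith, by nlinarith, ?_⟩
      rw [show P + 1 + Q = P + Q + 1 by ring, List.range_succ, List.map_append]
      simp only [List.map_cons, List.map_nil, if_pos h1, if_pos h3]
      rfl
    · have h1' := not_lt.1 (mt hua.2 h1)
      by_cases h2 : (((i : ℤ) + 1) * b) % (n : ℤ) < b
      · have h2' := hvb.1 h2
        have h3 := mt hc.1 (by
          rw [not_lt]
          refine le_of_mul_le_mul_left (a := n) ?_ hn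
          nlinarith [Nat.mul_le_mul_right b h1', Nat.mul_le_mul_right a h2'])
        refine ⟨P, Q + 1, by nlinarith, by nlinarith, by nlinarith, by nlinarith, ?_⟩
        rw [← add_assoc, List.range_succ, List.map_append]
        simp only [List.map_cons, List.map_nil, if_neg h1, if_pos h2, if_neg h3]
        rfl
      · have h2' := not_le.1 (mt hvb.2 h2)
        refine ⟨P, Q, by nlinarith, by nlinarith, by nlinarith, by nlinarith, ?_⟩
        simp [h1, h2]

theorem overlay_eq_map {n a b : ℕ} (han : a ≤ n) (hbn : b ≤ n) :
    overlay (christoffelC Letter.a Letter.z n a) (christoffelC Letter.b Letter.z n b).reverse =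
      (List.range n).map fun j : ℕ =>
        if (-((j : ℤ) * a)) % (n : ℤ) < a then Letter.a
        else if (((j : ℤ) + 1) * b) % (n : ℤ) < b then Letter.b else Letter.z := by
  rw [christoffelC_eq_map _ _ han, reverse_christoffelC_eq_map _ _ hbn, overlay,
    List.zipWith_map, List.zipWith_self]
  refine List.map_congr_left fun i _ => ?_
  split_ifs <;> simp_all

theorem removeZ_overlay {n a b : ℕ} (hn : 0 < n) (hpos : 0 < a + b) (han : a ≤ n) (hbn : b ≤ n)
    (hdisj : ∀ i : ℤ, ¬ ((-(i * a)) % (n : ℤ) < a ∧ ((i + 1) * b) % (n : ℤ) < b)) :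
    removeZ (overlay (christoffelC Letter.a Letter.z n a)
      (christoffelC Letter.b Letter.z n b).reverse) = christoffel Letter.a Letter.b a b := by
  obtain ⟨P, Q, h1, h2, h3, h4, h⟩ := exists_filter_prefix_eq hn hpos han hbn hdisj n
  have hP : P = a := by
    have := Nat.le_of_mul_le_mul_left (show n * a ≤ n * P by linarith) hn
    have := Nat.lt_of_mul_lt_mul_left (show n * P < n * (a + 1) by linarith)
    omega
  have hQ : Q = b := by
    have := Nat.le_of_mul_le_mul_left (show n * Q ≤ n * b by linarith) hn
    have := Nat.lt_of_mul_lt_mul_left (show n * b < n * (Q + 1) by linarith)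
    omega
  subst hP hQ
  rw [overlay_eq_map han hbn, removeZ, christoffel_eq_map]
  exact h

end ChristoffelSuperposition

open ChristoffelSuperposition in
theorem theorem5p4 (n α β : ℕ) (hαn : α ≤ n) (hβn : β ≤ n)
    (hα : Nat.Coprime n α) (hβ : Nat.Coprime n β) (hαβ : Nat.Coprime α β)
    (hsup : ChristoffelSuperposition.Superimposable
      ChristoffelSuperposition.Letter.a ChristoffelSuperposition.Letter.b
      (ChristoffelSuperposition.christoffelC
        ChristoffelSuperposition.Letter.a ChristoffelSuperposition.Letter.z n α)
      (ChristoffelSuperposition.christoffelC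
        ChristoffelSuperposition.Letter.b ChristoffelSuperposition.Letter.z n β))
    (u v : List ChristoffelSuperposition.Letter)
    (hu : u = ChristoffelSuperposition.christoffelC
      ChristoffelSuperposition.Letter.a ChristoffelSuperposition.Letter.z n α)
    (hv : v = (ChristoffelSuperposition.christoffelC
      ChristoffelSuperposition.Letter.b ChristoffelSuperposition.Letter.z n β).reverse) :
    List.IsRotated v (ChristoffelSuperposition.christoffelC
      ChristoffelSuperposition.Letter.b ChristoffelSuperposition.Letter.z n β) ∧
    ChristoffelSuperposition.PerfectlySuperimposable
      ChristoffelSuperposition.Letter.a ChristoffelSuperposition.Letter.b u v ∧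
    ChristoffelSuperposition.removeZ (ChristoffelSuperposition.overlay u v) =
      ChristoffelSuperposition.christoffel
        ChristoffelSuperposition.Letter.a ChristoffelSuperposition.Letter.b α β := by
  have hn : 0 < n := by
    rcases Nat.eq_zero_or_pos n with rfl | h
    · obtain rfl : α = 0 := by omega
      simp at hα
    · exact h
  have hn' : (0 : ℤ) < n := by exact_mod_cast hn
  have hpos : 0 < α + β := by
    rcases Nat.eq_zero_or_pos (α + β) with h | h
    · obtain ⟨rfl, rfl⟩ : α = 0 ∧ β = 0 := by omega
      simp at hαβ
    · exact h
  have hdisj : ∀ i : ℤ, ¬ ((-(i * α)) % (n : ℤ) < α ∧ ((i + 1) * β) % (n : ℤ) < β) := by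
    intro i
    rcases Nat.eq_zero_or_pos α with rfl | ha
    · simp
    rcases Nat.eq_zero_or_pos β with rfl | hb
    · simp
    have ha' : (0 : ℤ) < α := by exact_mod_cast ha
    have hb' : (0 : ℤ) < β := by exact_mod_cast hb
    have hab := Nat.isCoprime_iff_coprime.2 hαβ
    obtain ⟨k, hk⟩ := hsup
    obtain ⟨x, y, hx, hy, hxy⟩ := exists_positive_combination (k := k) ha' hb' hn'
      (by exact_mod_cast hαn) (by exact_mod_cast hβn) hab (Nat.isCoprime_iff_coprime.2 hα)
      fun i hi => by
        have hmem : i ∈ (∅ : Set ℤ) := hk ▸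
          ⟨(mem_periodicPositions_christoffelC (by decide) hn hαn i).2 hi.1,
            (mem_periodicPositions_christoffelC (by decide) hn hβn (i + k)).2 hi.2⟩
        exact hmem
    exact not_both_of_positive_combination ha' hb' hn' hab hx hy hxy i
  subst hu hv
  refine ⟨isRotated_reverse_christoffelC _ _ hn hβn hβ, ?_, removeZ_overlay hn hpos hαn hβn hdisj⟩
  refine Set.eq_empty_of_forall_notMem fun i hi => hdisj i
    ⟨(mem_periodicPositions_christoffelC (by decide) hn hαn i).1 hi.1, ?_⟩
  have h := (mem_periodicPositions_reverse_christoffelC (by decide) hn hβn (i + 0)).1 hi.2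
  rwa [add_zero] at h
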